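/- Let $B$ be a smooth connected manifold without boundary (Hausdorff, second countable), $p:\tilde B\to B$ a smooth universal covering, and $\Gamma\cong\pi_1(B)$ the group of covering transformations of $p$, acting on $\tilde B$ by diffeomorphisms. Let $F$ be a smooth $q$-dimensional manifold without boundary and $h:\Gamma\to \mathrm{Diff}(F)$ a group homomorphism. Let $M=(\tilde B\times F)/\Gamma$ be the quotient manifold for the action $\gamma(x,z)=(\gamma(x),h(\gamma)(z))$, and let $\mathcal F$ be the suspension foliation of $h$, whose leaves are the images in $M$ of the sets $\tilde B\times\{z\}$, $z\in F$. Assume that $M$ is compact, let $g$ be any smooth Riemannian metric on $M$ and $g_F$ any smooth Riemannian metric on $F$, and give $M$ and $F$ the corresponding Riemannian distances (with value $\infty$ between points of different connected components). For a space $X$ with a distance $d$, decomposed into a family of subsets (blocks), put $d(A,A')=\inf\{d(a,a'):a\in A,\,a'\in A'\}$ and $$\rho(L,L')=\inf\sum_{i=1}^{k-1} d(L_i,L_{i+1}),$$ the infimum being taken over all finite sequences of blocks $L_1=L,\dots,L_k=L'$. Identifying blocks $L,L'$ with $\rho(L,L')=0$ gives a metric space (with values in $[0,\infty]$) with the metric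 induced by $\rho$. For $(M,g)$ decomposed into the leaves of $\mathcal F$ this space is the Hausdorff leaf space $\mathrm{HLS}(\mathcal F)$; for $(F,g_F)$ decomposed into the orbits of the group $h(\Gamma)\subset\mathrm{Diff}(F)$ it is the Hausdorff orbit space $\mathrm{HOS}(F/h(\Gamma))$. Then $\mathrm{HLS}(\mathcal F)$ is homeomorphic to $\mathrm{HOS}(F/h(\Gamma))$. -/

import Mathlib

open scoped Bundle Manifold ContDiff Topology ENNReal
open Set

noncomputable section

namespace SuspensionHLS

/-! ### Gluing the blocks of a decomposition of a metric space -/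

section HausdorffQuotient

variable {X : Type*}

/-- The distance of two subsets, `inf {d a b : a ∈ A, b ∈ B}`. -/
def setDist (m : PseudoEMetricSpace X) (A B : Set X) : ℝ≥0∞ :=
  ⨅ (a ∈ A) (b ∈ B), m.edist a b

/-- A block of a family `𝓟` of subsets of the (extended) metric space `(X, m)`. -/
structure Block (m : PseudoEMetricSpace X) (𝓟 : Set (Set X)) where
  carrier : Set X
  mem : carrier ∈ 𝓟

variable {m : PseudoEMetricSpace X} {𝓟 : Set (Set X)}

/-- `ρ(L, L') = inf ∑ dist (Lᵢ, Lᵢ₊₁)` over all finite sequences of blocks from `L` to `L'`. -/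
def chainDist (L L' : Block m 𝓟) : ℝ≥0∞ :=
  ⨅ (k : ℕ) (c : ℕ → Block m 𝓟) (_ : c 0 = L ∧ c k = L'),
    ∑ i ∈ Finset.range k, setDist m (c i).carrier (c (i + 1)).carrier

theorem setDist_comm (A B : Set X) : setDist m A B = setDist m B A := by
  unfold setDist
  have h : ∀ A B : Set X, (⨅ (a ∈ A) (b ∈ B), m.edist a b) ≤ ⨅ (a ∈ B) (b ∈ A), m.edist a b := by
    intro A B
    refine le_iInf₂ fun b hb => le_iInf₂ fun a ha => ?_
    rw [m.edist_comm b a]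
    exact iInf₂_le_of_le a ha (iInf₂_le b hb)
  exact le_antisymm (h A B) (h B A)

theorem chainDist_self (L : Block m 𝓟) : chainDist L L = 0 := by
  refine le_antisymm ?_ bot_le
  refine iInf_le_of_le 0 (iInf_le_of_le (fun _ => L) (iInf_le_of_le ⟨rfl, rfl⟩ ?_))
  simp

theorem chainDist_comm (L L' : Block m 𝓟) : chainDist L L' = chainDist L' L := by
  have h : ∀ L L' : Block m 𝓟, chainDist L L' ≤ chainDist L' L := by
    intro L L'
    refine le_iInf fun k => le_iInf fun c => le_iInf fun hc => ?_
    refine iInf_le_of_le k (iInf_le_of_le (fun i => c (k - i)) (iInf_le_of_le ?_ (le_of_eq ?_)))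
    · simpa using hc.symm
    · rw [← Finset.sum_range_reflect]
      refine Finset.sum_congr rfl fun i hi => ?_
      have hi' := Finset.mem_range.1 hi
      have e1 : k - (k - 1 - i) = i + 1 := by omega
      have e2 : k - (k - 1 - i + 1) = i := by omega
      simp only [e1, e2]
      exact setDist_comm _ _
  exact le_antisymm (h _ _) (h _ _)

theorem chainDist_triangle (L L' L'' : Block m 𝓟) :
    chainDist L L'' ≤ chainDist L L' + chainDist L' L'' := by
  conv_rhs => unfold chainDist
  simp only [ENNReal.iInf_add, ENNReal.add_iInf]
  refine le_iInf fun k₂ => le_iInf fun c₂ => le_iInf fun h₂ =>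
    le_iInf fun k₁ => le_iInf fun c₁ => le_iInf fun h₁ => ?_
  refine iInf_le_of_le (k₁ + k₂)
    (iInf_le_of_le (fun i => if i ≤ k₁ then c₁ i else c₂ (i - k₁)) (iInf_le_of_le ?_ (le_of_eq ?_)))
  · refine ⟨by simpa using h₁.1, ?_⟩
    rcases Nat.eq_zero_or_pos k₂ with rfl | hk
    · simpa [h₁.2, h₂.1] using h₂.2
    · have : ¬ (k₁ + k₂ ≤ k₁) := by omega
      simpa [this] using h₂.2
  · rw [Finset.sum_range_add]
    congr 1
    · refine Finset.sum_congr rfl fun i hi => ?_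
      have hi' := Finset.mem_range.1 hi
      beta_reduce
      rw [if_pos (by omega), if_pos (by omega)]
    · refine Finset.sum_congr rfl fun i _ => ?_
      have e : k₁ + i + 1 - k₁ = i + 1 := by omega
      beta_reduce
      rw [if_neg (by omega : ¬ (k₁ + i + 1 ≤ k₁)), e]
      rcases Nat.eq_zero_or_pos i with rfl | hi
      · simp [h₁.2, h₂.1]
      · rw [if_neg (by omega), Nat.add_sub_cancel_left]

/-- The pseudometric `ρ` on the set of blocks. -/
instance : PseudoEMetricSpace (Block m 𝓟) where
  edist := chainDist
  edist_self := chainDist_self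
  edist_comm := chainDist_comm
  edist_triangle := chainDist_triangle

/-- The metric space obtained from the set of blocks of `𝓟` with the pseudometric `ρ` by
identifying `L` with `L'` whenever `ρ(L, L') = 0`. -/
abbrev HausdorffQuotient (m : PseudoEMetricSpace X) (𝓟 : Set (Set X)) : Type _ :=
  SeparationQuotient (Block m 𝓟)

/-- The Hausdorff orbit space of the action of `G` on `(X, m)`. -/
abbrev HOS (G : Type*) [Group G] [MulAction G X] (m : PseudoEMetricSpace X) : Type _ :=
  HausdorffQuotient m (range fun x : X => MulAction.orbit G x)

/-- The points of the Hausdorff quotient are the classes for the relation `ρ(L, L') = 0`, and its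
distance is induced by `ρ`. -/
theorem hausdorffQuotient_mk_eq_iff (L L' : Block m 𝓟) :
    (SeparationQuotient.mk L : HausdorffQuotient m 𝓟) = SeparationQuotient.mk L' ↔
      chainDist L L' = 0 := by
  rw [SeparationQuotient.mk_eq_mk, EMetric.inseparable_iff]
  rfl

end HausdorffQuotient

/-! ### The Riemannian distance -/

section RiemannianDistance

variable {E : Type*} [NormedAddCommGroup E] [NormedSpace ℝ E]
  {H : Type*} [TopologicalSpace H] {I : ModelWithCorners ℝ E H}
  {M : Type*} [TopologicalSpace M] [ChartedSpace H M] [IsManifold I ∞ M]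

/-- A smooth Riemannian metric on `M`. -/
abbrev Metric (I : ModelWithCorners ℝ E H) (M : Type*) [TopologicalSpace M] [ChartedSpace H M]
    [IsManifold I ∞ M] : Type _ :=
  Bundle.ContMDiffRiemannianMetric I ∞ E (fun x : M => TangentSpace I x)

/-- The Riemannian distance of `g`: the infimum of the `g`-lengths of the `C¹` paths between two
points, so that it is `∞` between points of different components. -/
@[reducible] def Metric.dist (g : Metric I M) : PseudoEMetricSpace M :=
  letI : Bundle.RiemannianBundle (fun x : M => TangentSpace I x) := ⟨g.toRiemannianMetric⟩
  { edist := fun x y => Manifold.riemannianEDist I x y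
    edist_self := fun _ => Manifold.riemannianEDist_self
    edist_comm := fun _ _ => Manifold.riemannianEDist_comm
    edist_triangle := fun _ _ _ => Manifold.riemannianEDist_triangle }

/-- The Hausdorff leaf space of the Riemannian manifold `(M, g)` decomposed into the leaves `𝓛`. -/
abbrev HLS (𝓛 : Set (Set M)) (g : Metric I M) : Type _ :=
  HausdorffQuotient g.dist 𝓛

end RiemannianDistance

/-! ### Groups of diffeomorphisms -/

section DiffeomorphismGroup

variable {E : Type*} [NormedAddCommGroup E] [NormedSpace ℝ E]
  {H : Type*} [TopologicalSpace H] {I : ModelWithCorners ℝ E H}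
  {M : Type*} [TopologicalSpace M] [ChartedSpace H M]

/-- `Diff(M)`, with composition as the product. -/
instance : Group (M ≃ₘ⟮I, I⟯ M) where
  mul f g := g.trans f
  one := Diffeomorph.refl I M ∞
  inv f := f.symm
  mul_assoc _ _ _ := Diffeomorph.ext fun _ => rfl
  one_mul _ := Diffeomorph.ext fun _ => rfl
  mul_one _ := Diffeomorph.ext fun _ => rfl
  inv_mul_cancel f := Diffeomorph.ext fun x => f.symm_apply_apply x

/-- `Diff(M)` acts on `M` by evaluation. -/
instance : MulAction (M ≃ₘ⟮I, I⟯ M) M where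
  smul f x := f x
  one_smul _ := rfl
  mul_smul _ _ _ := rfl

end DiffeomorphismGroup

/-! ### Smooth structure on the base of a local homeomorphism -/

section Pushforward

variable {E : Type*} [NormedAddCommGroup E] [NormedSpace ℝ E]
  {H : Type*} [TopologicalSpace H] {I : ModelWithCorners ℝ E H}
  {M : Type*} [TopologicalSpace M] [ChartedSpace H M] [IsManifold I ∞ M]
  {N : Type*} [TopologicalSpace N]

theorem isManifold_of_isLocalHomeomorph {f : M → N} (hf : IsLocalHomeomorph f)
    (hs : Function.Surjective f)
    (hG : ∀ a b, f a = f b → ∃ γ : M ≃ₘ⟮I, I⟯ M, γ a = b ∧ ∀ x, f (γ x) = f x) :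
    @IsManifold ℝ _ E _ _ H _ I ∞ N _ (hf.chartedSpace hs) := by
  let : ChartedSpace H N := hf.chartedSpace hs
  apply isManifold_of_contDiffOn
  rintro _ _ ⟨q, rfl⟩ ⟨q', rfl⟩
  set g := hs.hasRightInverse.choose
  set l := hf.localInverseAt (g q) with hl
  set l' := hf.localInverseAt (g q') with hl'
  set c := chartAt H (g q)
  set c' := chartAt H (g q')
  have hlsymm : ∀ y, l.symm y = f y := fun y => congrFun (hf.localInverseAt_symm _) y
  have hl'symm : ∀ y, l'.symm y = f y := fun y => congrFun (hf.localInverseAt_symm _) y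
  rw [← contMDiffOn_iff_contDiffOn]
  rintro x ⟨hx, hxr⟩
  simp only [mfld_simps] at hx
  obtain ⟨⟨hx1, hx2⟩, hx3, hx4⟩ := hx
  rw [hlsymm] at hx3 hx4
  set u := I.symm x
  set a := c.symm u
  -- the point of the second sheet over the same point of the base
  obtain ⟨γ, hγa, hγ⟩ := hG a (l' (f a)) (hf.apply_localInverseAt_of_mem hx3).symm
  have hb : l' (f a) ∈ l'.target := l'.map_source hx3
  have key : ∀ᶠ y in 𝓝 a, l' (f y) = γ y := by
    have h1 : ∀ᶠ y in 𝓝 a, γ y ∈ l'.target := by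
      refine γ.continuous.continuousAt.eventually_mem (l'.open_target.mem_nhds ?_)
      rw [hγa]; exact hb
    filter_upwards [h1] with y hy
    have := l'.right_inv hy
    rw [hl'symm, hγ] at this
    exact this
  have hcont : ContinuousAt (fun z => c.symm (I.symm z)) x :=
    (c.symm.continuousAt (by simpa using hx1)).comp I.continuous_symm.continuousAt
  have key' : ∀ᶠ z in 𝓝 x, l' (f (c.symm (I.symm z))) = γ (c.symm (I.symm z)) :=
    hcont.eventually key
  have hsm : ContMDiffWithinAt 𝓘(ℝ, E) 𝓘(ℝ, E) ∞
      (fun z => I (c' (γ (c.symm (I.symm z))))) (range I) x := by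
    have s1 : ContMDiffWithinAt 𝓘(ℝ, E) I ∞ I.symm (range I) x :=
      I.contMDiffOn_symm x hxr
    have s2 : ContMDiffAt I I ∞ c.symm u :=
      contMDiffAt_symm_of_mem_maximalAtlas (IsManifold.chart_mem_maximalAtlas _) hx1
    have s3 : ContMDiffAt I I ∞ γ a := γ.contMDiff.contMDiffAt
    have s4 : ContMDiffAt I I ∞ c' (γ a) :=
      contMDiffAt_of_mem_maximalAtlas (IsManifold.chart_mem_maximalAtlas _) (by rw [hγa]; exact hx4)
    have s5 : ContMDiffAt I 𝓘(ℝ, E) ∞ I (c' (γ a)) := I.contMDiff.contMDiffAt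
    exact (s5.comp (f := c') (γ a) s4 |>.comp (f := γ) a s3
      |>.comp (f := c.symm) u s2).comp_contMDiffWithinAt (f := I.symm) x s1
  refine (hsm.mono inter_subset_right).congr_of_eventuallyEq ?_ ?_
  · filter_upwards [nhdsWithin_le_nhds key'] with z hz
    simp [hlsymm, hz]
  · simp [hlsymm, key'.self_of_nhds]

end Pushforward

/-! ### The suspension -/

section Suspension

variable {n q : ℕ}
  {B : Type*} [TopologicalSpace B] [ChartedSpace (EuclideanSpace ℝ (Fin n)) B]
  {B' : Type*} [TopologicalSpace B'] [ChartedSpace (EuclideanSpace ℝ (Fin n)) B']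
  {F : Type*} [TopologicalSpace F] [ChartedSpace (EuclideanSpace ℝ (Fin q)) F]

/-- A smooth universal covering `B' → B`. -/
structure UniversalCovering (n : ℕ)
    (B' : Type*) [TopologicalSpace B'] [ChartedSpace (EuclideanSpace ℝ (Fin n)) B']
    (B : Type*) [TopologicalSpace B] [ChartedSpace (EuclideanSpace ℝ (Fin n)) B] where
  toFun : B' → B
  surjective : Function.Surjective toFun
  isCoveringMap : IsCoveringMap toFun
  isLocalDiffeomorph : IsLocalDiffeomorph (𝓡 n) (𝓡 n) ∞ toFun
  simplyConnected : SimplyConnectedSpace B'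

/-- The group `Γ` of covering transformations. -/
def UniversalCovering.deck (p : UniversalCovering n B' B) : Subgroup (B' ≃ₘ⟮𝓡 n, 𝓡 n⟯ B') where
  carrier := {γ | ∀ x, p.toFun (γ x) = p.toFun x}
  mul_mem' {γ δ} hγ hδ x := (hγ (δ x)).trans (hδ x)
  one_mem' _ := rfl
  inv_mem' {γ} hγ x := by
    have := hγ (γ.symm x)
    rw [γ.apply_symm_apply] at this
    exact this.symm

variable (p : UniversalCovering n B' B) (h : p.deck →* (F ≃ₘ⟮𝓡 q, 𝓡 q⟯ F))

/-- The action `γ • (x, z) = (γ x, h(γ) z)` of `Γ` on `B' × F`. -/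
@[reducible] def suspensionAction : MulAction p.deck (B' × F) where
  smul γ a := (γ.1 a.1, h γ a.2)
  one_smul a := by
    change ((1 : p.deck).1 a.1, h 1 a.2) = a
    rw [map_one]; rfl
  mul_smul γ δ a := by
    change ((γ * δ).1 a.1, h (γ * δ) a.2) = (γ.1 (δ.1 a.1), h γ (h δ a.2))
    rw [map_mul]; rfl

/-- The total space `M = (B' × F) / Γ` of the suspension, with the quotient topology. -/
def Suspension : Type _ := @MulAction.orbitRel.Quotient p.deck (B' × F) _ (suspensionAction p h)

/-- The canonical projection `B' × F → M`. -/
def Suspension.proj (a : B' × F) : Suspension p h :=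
  Quotient.mk (@MulAction.orbitRel p.deck (B' × F) _ (suspensionAction p h)) a

instance : TopologicalSpace (Suspension p h) :=
  inferInstanceAs (TopologicalSpace (Quotient _))

theorem Suspension.proj_surjective : Function.Surjective (Suspension.proj p h) :=
  Quotient.mk_surjective

theorem Suspension.proj_eq_iff {a b : B' × F} :
    Suspension.proj p h a = Suspension.proj p h b ↔
      ∃ γ : p.deck, (γ.1 b.1, h γ b.2) = a := by
  let := suspensionAction p h
  exact Quotient.eq''

theorem Suspension.isQuotientCoveringMap_proj :
    @IsQuotientCoveringMap _ _ _ _ (Suspension.proj p h) p.deck _ (suspensionAction p h) := by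
  let := suspensionAction p h
  have := p.simplyConnected
  have : ContinuousConstSMul p.deck (B' × F) := ⟨fun γ =>
    (γ.1.continuous.comp continuous_fst).prodMk ((h γ).continuous.comp continuous_snd)⟩
  refine (isQuotientCoveringMap_iff ..).2 ⟨isQuotientMap_quotient_mk', this, Quotient.eq'', ?_⟩
  rintro ⟨x, z⟩
  -- a neighbourhood on which the covering is injective meets none of its translates
  obtain ⟨U, hU, hxU, hinj⟩ := isLocallyInjective_iff_nhds.1
    p.isCoveringMap.isLocalHomeomorph.isLocallyInjective x |>.imp fun U hU =>
      (⟨hU.1, mem_of_mem_nhds hU.1, hU.2⟩ : U ∈ 𝓝 x ∧ x ∈ U ∧ InjOn p.toFun U)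
  refine ⟨U ×ˢ univ, prod_mem_nhds hU Filter.univ_mem, ?_⟩
  rintro γ ⟨_, ⟨⟨y, w⟩, ⟨hy, -⟩, rfl⟩, hγy, -⟩
  have hfix : γ.1 y = y := hinj hγy hy (γ.2 y)
  have : (γ.1 : B' → B') = id :=
    p.isCoveringMap.eq_of_comp_eq γ.1.continuous continuous_id (funext fun x => γ.2 x) y hfix
  exact Subtype.ext (Diffeomorph.ext fun x => congrFun this x)

theorem Suspension.isLocalHomeomorph_proj : IsLocalHomeomorph (Suspension.proj p h) := by
  let := suspensionAction p h
  exact (Suspension.isQuotientCoveringMap_proj p h).isCoveringMap.isLocalHomeomorph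

/-- The charts of `M` are the charts of `B' × F` composed with local inverses of the canonical
projection. -/
instance : ChartedSpace (ModelProd (EuclideanSpace ℝ (Fin n)) (EuclideanSpace ℝ (Fin q)))
    (Suspension p h) :=
  (Suspension.isLocalHomeomorph_proj p h).chartedSpace (Suspension.proj_surjective p h)

instance [IsManifold (𝓡 n) ∞ B'] [IsManifold (𝓡 q) ∞ F] :
    IsManifold ((𝓡 n).prod (𝓡 q)) ∞ (Suspension p h) := by
  refine isManifold_of_isLocalHomeomorph (Suspension.isLocalHomeomorph_proj p h)
    (Suspension.proj_surjective p h) fun a b hab => ?_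
  obtain ⟨γ, hγ⟩ := (Suspension.proj_eq_iff p h).1 hab.symm
  exact ⟨γ.1.prodCongr (h γ), hγ, fun x => (Suspension.proj_eq_iff p h).2 ⟨γ, rfl⟩⟩

/-- The leaves of the suspension foliation: the images in `M` of the sets `B' × {z}`, `z ∈ F`. -/
def Suspension.leaves : Set (Set (Suspension p h)) :=
  range fun z : F => Suspension.proj p h '' (univ ×ˢ {z})

end Suspension

end SuspensionHLS

end

/-!
The leaf space and the orbit space are indexed by the same set: `z ∈ F` gives the leaf that is the
image of `B' × {z}`, and the orbit of `z`. The two pseudodistances that `ρ` induces on `F` turn out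
to be bounded by multiples of each other, so that their metric quotients are homeomorphic
(`nonempty_separationQuotient_homeomorph`).

Both bounds come from one principle (`exists_le_mul_dist`). Let `e` be a pseudodistance on a compact
Riemannian manifold `M` such that near each point `e` is bounded by the pullback of a Riemannian
distance under a `C¹` map. Derivatives of `C¹` maps are locally bounded, so `e` between the ends of
a short path is at most a constant times its length; by compactness one constant serves all of `M`,
and cutting a path into short pieces gives `e ≤ C d` globally.

* Orbits against leaves (`exists_edist_orbitBlock_le`): on the compact manifold `M`, the distance of
  the orbits that correspond to two points is locally bounded by the pullback of the distance of `F`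
  under the second coordinate of a smooth local section of `B' × F → M`.
* Leaves against orbits (`exists_edist_leafBlock_le`): the distance of the leaves indexed by `z` and
  `w` is bounded by the pullback of the distance of `M` under `z ↦ [x₀, z]`. Here `F` has to be
  compact, which it is, being homeomorphic to a closed subset of `M` (`compactSpace_fibre`).

Since `ρ` is the largest pseudodistance below the distance of blocks, these bounds pass from points
to blocks (`edist_le_mul_edist_block`).
-/

namespace SuspensionHLS

open MeasureTheory Manifold
open scoped NNReal

/-! ### Paths and the Riemannian distance -/

section Paths

variable {E : Type*} [NormedAddCommGroup E] [NormedSpace ℝ E]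
  {H : Type*} [TopologicalSpace H] {I : ModelWithCorners ℝ E H}
  {M : Type*} [TopologicalSpace M] [ChartedSpace H M]
  [Bundle.RiemannianBundle (fun x : M => TangentSpace I x)]

/-- On a compact Riemannian manifold, a pseudodistance that is locally dominated by the length of
paths is globally dominated by a multiple of the Riemannian distance. -/
theorem exists_le_riemannianEDist [CompactSpace M] {e : M → M → ℝ≥0∞} (e_self : ∀ x, e x x = 0)
    (e_triangle : ∀ x y z, e x z ≤ e x y + e y z)
    (he : ∀ x : M, ∃ C : ℝ≥0, ∃ U ∈ 𝓝 x, ∀ (γ : ℝ → M) (a b : ℝ), a ≤ b →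
      ContMDiffOn 𝓘(ℝ, ℝ) I 1 γ (Icc a b) → MapsTo γ (Icc a b) U →
      e (γ a) (γ b) ≤ C * pathELength I γ a b) :
    ∃ C : ℝ≥0, C ≠ 0 ∧ ∀ x y, e x y ≤ C * riemannianEDist I x y := by
  choose C U hU hCU using he
  obtain ⟨s, hs⟩ := CompactSpace.elim_nhds_subcover (fun x => interior (U x))
    fun x => interior_mem_nhds.2 (hU x)
  have hC : ∀ x ∈ s, C x ≤ s.sup C + 1 := fun x hx =>
    (Finset.le_sup (f := C) hx).trans (le_add_of_nonneg_right zero_le_one)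
  -- the summand `1` makes the constant invertible, which matters at infinite distance
  refine ⟨s.sup C + 1, by simp, fun x y => ?_⟩
  have hK : (((s.sup C + 1 : ℝ≥0)) : ℝ≥0∞) ≠ 0 := by simp
  generalize s.sup C + 1 = K at hC hK ⊢
  rw [mul_comm, ← ENNReal.div_le_iff hK ENNReal.coe_ne_top]
  refine le_of_forall_gt fun r hr => ?_
  obtain ⟨γ, rfl, rfl, hγ, hlen⟩ := exists_lt_of_riemannianEDist_lt hr
  refine lt_of_le_of_lt ?_ hlen
  rw [ENNReal.div_le_iff hK ENNReal.coe_ne_top, mul_comm]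
  obtain ⟨t, ht0, htm, ⟨k, hk⟩, htU⟩ := exists_monotone_Icc_subset_open_cover_unitInterval
    (c := fun x : s => (Icc (0 : ℝ) 1).domRestrict γ ⁻¹' interior (U x))
    (fun x => isOpen_interior.preimage hγ.continuousOn.domRestrict) (fun τ _ => by
      have : γ τ ∈ ⋃ x ∈ s, interior (U x) := hs ▸ mem_univ _
      simpa [domRestrict_apply] using this)
  have step : ∀ j, e (γ 0) (γ (t j)) ≤ K * pathELength I γ 0 (t j) := by
    intro j
    induction j with
    | zero => simp [ht0, e_self]
    | succ j ih =>
      have hj : (t j : ℝ) ≤ t (j + 1) := htm j.le_succ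
      obtain ⟨⟨x, hx⟩, hxU⟩ := htU j
      have hsub : Icc (t j : ℝ) (t (j + 1)) ⊆ Icc 0 1 :=
        Icc_subset_Icc (t j).2.1 (t (j + 1)).2.2
      have hpiece := hCU x γ (t j) (t (j + 1)) hj (hγ.mono hsub) fun τ hτ =>
        interior_subset (hxU (show (⟨τ, hsub hτ⟩ : unitInterval) ∈ _ from hτ))
      calc e (γ 0) (γ (t (j + 1))) ≤ e (γ 0) (γ (t j)) + e (γ (t j)) (γ (t (j + 1))) :=
            e_triangle _ _ _
        _ ≤ K * pathELength I γ 0 (t j) + K * pathELength I γ (t j) (t (j + 1)) := by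
            gcongr
            refine hpiece.trans ?_
            gcongr
            exact hC x hx
        _ = K * pathELength I γ 0 (t (j + 1)) := by
            rw [← mul_add, pathELength_add (t j).2.1 hj]
  simpa [hk k le_rfl] using step k

variable [IsManifold I 1 M] [IsContinuousRiemannianBundle E (fun x : M => TangentSpace I x)]
  {E' : Type*} [NormedAddCommGroup E'] [NormedSpace ℝ E']
  {H' : Type*} [TopologicalSpace H'] {I' : ModelWithCorners ℝ E' H'}
  {N : Type*} [TopologicalSpace N] [ChartedSpace H' N] [IsManifold I' 1 N]
  [Bundle.RiemannianBundle (fun x : N => TangentSpace I' x)]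
  [IsContinuousRiemannianBundle E' (fun x : N => TangentSpace I' x)]

/-- The derivative of a `C¹` map is locally bounded: it is continuous when read in trivializations of
the tangent bundles, and these are locally bounded for continuous Riemannian metrics. -/
theorem eventually_enorm_mfderiv_le {φ : M → N} {x : M} (hφ : ContMDiffAt I I' 1 φ x) :
    ∃ C : ℝ≥0, ∀ᶠ y in 𝓝 x, ∀ v : TangentSpace I y, ‖mfderiv I I' φ y v‖ₑ ≤ C * ‖v‖ₑ := by
  obtain ⟨C₁, hC₁, h₁⟩ :=
    eventually_norm_trivializationAt_lt E (fun x : M => TangentSpace I x) x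
  obtain ⟨C₃, hC₃, h₃⟩ :=
    eventually_norm_symmL_trivializationAt_lt E' (fun x : N => TangentSpace I' x) (φ x)
  have hcont : ContinuousAt (inTangentCoordinates I I' id φ (mfderiv I I' φ) x) x :=
    (hφ.mfderiv_const (m := 0) (by simp)).continuousAt
  obtain ⟨C₂, hC₂, h₂⟩ : ∃ C₂ : ℝ, 0 < C₂ ∧
      ∀ᶠ y in 𝓝 x, ‖inTangentCoordinates I I' id φ (mfderiv I I' φ) x y‖ < C₂ :=
    ⟨‖inTangentCoordinates I I' id φ (mfderiv I I' φ) x x‖ + 1, by positivity,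
      hcont.norm.eventually_lt_const (lt_add_one _)⟩
  refine ⟨(C₃ * (C₂ * C₁)).toNNReal, ?_⟩
  filter_upwards [h₁, h₂, hφ.continuousAt.eventually h₃, chart_source_mem_nhds H x,
    hφ.continuousAt.preimage_mem_nhds (chart_source_mem_nhds H' (φ x))] with y hy₁ hy₂ hy₃ hyx hyφ v
  set T := trivializationAt E (fun x : M => TangentSpace I x) x
  set T' := trivializationAt E' (fun x : N => TangentSpace I' x) (φ x)
  have hT : y ∈ T.baseSet := by simpa [T] using hyx
  have hT' : φ y ∈ T'.baseSet := by simpa [T'] using hyφ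
  have key : mfderiv I I' φ y v = T'.symmL ℝ (φ y)
      (inTangentCoordinates I I' id φ (mfderiv I I' φ) x y (T.continuousLinearMapAt ℝ y v)) := by
    change _ = T'.symmL ℝ (φ y) (T'.continuousLinearMapAt ℝ (φ y)
      (mfderiv I I' φ y (T.symmL ℝ y (T.continuousLinearMapAt ℝ y v))))
    rw [T.symmL_continuousLinearMapAt hT, T'.symmL_continuousLinearMapAt hT']
  have hn : ‖mfderiv I I' φ y v‖ ≤ (C₃ * (C₂ * C₁)) * ‖v‖ := by
    rw [key]
    calc _ ≤ ‖T'.symmL ℝ (φ y)‖ * (‖inTangentCoordinates I I' id φ (mfderiv I I' φ) x y‖ *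
          (‖T.continuousLinearMapAt ℝ y‖ * ‖v‖)) := by
          refine (ContinuousLinearMap.le_opNorm _ _).trans ?_
          gcongr
          refine (ContinuousLinearMap.le_opNorm _ _).trans ?_
          gcongr
          exact ContinuousLinearMap.le_opNorm _ _
      _ ≤ C₃ * (C₂ * (C₁ * ‖v‖)) := by
          gcongr
      _ = _ := by ring
  rw [← ofReal_norm, ← ofReal_norm]
  change _ ≤ ENNReal.ofReal (C₃ * (C₂ * C₁)) * _
  rw [← ENNReal.ofReal_mul (by positivity)]
  exact ENNReal.ofReal_le_ofReal hn

/-- A `C¹` map is locally Lipschitz, in a form that compares with the length of paths that stay near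
the given point. -/
theorem exists_pathELength_comp_le {φ : M → N} {x : M} (hφ : ContMDiffAt I I' 1 φ x) :
    ∃ C : ℝ≥0, ∃ U ∈ 𝓝 x, ∀ (γ : ℝ → M) (a b : ℝ), a ≤ b → ContMDiffOn 𝓘(ℝ, ℝ) I 1 γ (Icc a b) →
      MapsTo γ (Icc a b) U →
      riemannianEDist I' (φ (γ a)) (φ (γ b)) ≤ C * pathELength I γ a b := by
  obtain ⟨C, hC⟩ := eventually_enorm_mfderiv_le (I := I) (I' := I') hφ
  refine ⟨C, _, hC.and ((contMDiffAt_iff_contMDiffAt_nhds (by simp)).1 hφ), fun γ a b hab hγ hU => ?_⟩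
  have hφγ : ContMDiffOn 𝓘(ℝ, ℝ) I' 1 (φ ∘ γ) (Icc a b) := fun t ht =>
    (hU ht).2.comp_contMDiffWithinAt t (hγ t ht)
  refine (riemannianEDist_le_pathELength hφγ rfl rfl hab).trans ?_
  rcases hab.eq_or_lt with rfl | hab
  · simp
  rw [pathELength_eq_lintegral_mfderivWithin_Icc, pathELength_eq_lintegral_mfderivWithin_Icc,
    ← lintegral_const_mul' _ _ ENNReal.coe_ne_top]
  refine setLIntegral_mono' measurableSet_Icc fun t ht => ?_
  rw [mfderiv_comp_mfderivWithin t ((hU ht).2.mdifferentiableAt one_ne_zero)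
    ((hγ t ht).mdifferentiableWithinAt one_ne_zero)
    (uniqueMDiffWithinAt_iff_uniqueDiffWithinAt.2 (uniqueDiffOn_Icc hab t ht))]
  exact (hU ht).1 _

end Paths

section Metrics

variable {E : Type*} [NormedAddCommGroup E] [NormedSpace ℝ E]
  {H : Type*} [TopologicalSpace H] {I : ModelWithCorners ℝ E H}
  {M : Type*} [TopologicalSpace M] [ChartedSpace H M] [IsManifold I ∞ M]
  {E' : Type*} [NormedAddCommGroup E'] [NormedSpace ℝ E']
  {H' : Type*} [TopologicalSpace H'] {I' : ModelWithCorners ℝ E' H'}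
  {N : Type*} [TopologicalSpace N] [ChartedSpace H' N] [IsManifold I' ∞ N]

/-- On a compact Riemannian manifold `M`, a pseudodistance that is locally bounded by the pullback
of a Riemannian distance under a `C¹` map is bounded by a multiple of the distance of `M`. -/
theorem exists_le_mul_dist [CompactSpace M] (g : Metric I M) (gN : Metric I' N)
    {e : M → M → ℝ≥0∞} (e_self : ∀ x, e x x = 0) (e_triangle : ∀ x y z, e x z ≤ e x y + e y z)
    (he : ∀ x, ∃ φ : M → N, ContMDiffAt I I' 1 φ x ∧
      ∃ U ∈ 𝓝 x, ∀ y ∈ U, ∀ y' ∈ U, e y y' ≤ gN.dist.edist (φ y) (φ y')) :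
    ∃ C : ℝ≥0, C ≠ 0 ∧ ∀ x y, e x y ≤ C * g.dist.edist x y := by
  let : Bundle.RiemannianBundle (fun x : M => TangentSpace I x) := ⟨g.toRiemannianMetric⟩
  let : Bundle.RiemannianBundle (fun x : N => TangentSpace I' x) := ⟨gN.toRiemannianMetric⟩
  have : IsContinuousRiemannianBundle E (fun x : M => TangentSpace I x) :=
    ⟨⟨g.inner, g.contMDiff.continuous, fun _ _ _ => rfl⟩⟩
  have : IsContinuousRiemannianBundle E' (fun x : N => TangentSpace I' x) :=
    ⟨⟨gN.inner, gN.contMDiff.continuous, fun _ _ _ => rfl⟩⟩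
  refine exists_le_riemannianEDist (I := I) e_self e_triangle fun x => ?_
  obtain ⟨φ, hφ, U, hU, hUe⟩ := he x
  obtain ⟨C, V, hV, hVC⟩ := exists_pathELength_comp_le (I := I) (I' := I') hφ
  refine ⟨C, U ∩ V, Filter.inter_mem hU hV, fun γ a b hab hγ hγU => ?_⟩
  exact (hUe _ (hγU (left_mem_Icc.2 hab)).1 _ (hγU (right_mem_Icc.2 hab)).1).trans
    (hVC γ a b hab hγ fun t ht => (hγU ht).2)

end Metrics
/-! ### Pseudodistances on the set of blocks -/

section Blocks

variable {X : Type*} {m : PseudoEMetricSpace X} {𝓑 : Set (Set X)}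

/-- The pseudometric `ρ` is the largest one that is bounded by the distance of blocks: a bound of a
pseudodistance by distances of points passes to `ρ`. -/
theorem le_mul_edist_block {e : Block m 𝓑 → Block m 𝓑 → ℝ≥0∞} (e_self : ∀ L, e L L = 0)
    (e_triangle : ∀ L L' L'', e L L'' ≤ e L L' + e L' L'') {C : ℝ≥0} (hC : C ≠ 0)
    (he : ∀ L L', ∀ a ∈ L.carrier, ∀ b ∈ L'.carrier, e L L' ≤ C * m.edist a b)
    (L L' : Block m 𝓑) : e L L' ≤ C * edist L L' := by
  change e L L' ≤ C * chainDist L L'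
  have hC' : (C : ℝ≥0∞) ≠ 0 := ENNReal.coe_ne_zero.2 hC
  have hset : ∀ L L', e L L' ≤ C * setDist m L.carrier L'.carrier := fun L L' => by
    simp only [setDist, ENNReal.mul_iInf_of_ne hC' ENNReal.coe_ne_top]
    exact le_iInf₂ fun a ha => le_iInf₂ fun b hb => he L L' a ha b hb
  simp only [chainDist, ENNReal.mul_iInf_of_ne hC' ENNReal.coe_ne_top]
  refine le_iInf fun k => le_iInf fun c => le_iInf fun hc => ?_
  have step : ∀ j, e (c 0) (c j) ≤
      C * ∑ i ∈ Finset.range j, setDist m (c i).carrier (c (i + 1)).carrier := by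
    intro j
    induction j with
    | zero => simp [e_self]
    | succ j ih =>
      rw [Finset.sum_range_succ, mul_add]
      exact (e_triangle _ _ _).trans (add_le_add ih (hset _ _))
  simpa [hc.1, hc.2] using step k

/-- A map `u` on the index set of the blocks that is Lipschitz for the distances of points of the
blocks is Lipschitz for `ρ`. -/
theorem edist_le_mul_edist_block {ι Y : Type*} [PseudoEMetricSpace Y] {u : ι → Y}
    {v : ι → Block m 𝓑} (hv : Function.Surjective v) (hne : ∀ z, (v z).carrier.Nonempty)
    {C : ℝ≥0} (hC : C ≠ 0)
    (huv : ∀ z w, ∀ a ∈ (v z).carrier, ∀ b ∈ (v w).carrier, edist (u z) (u w) ≤ C * m.edist a b)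
    (z w : ι) : edist (u z) (u w) ≤ C * edist (v z) (v w) := by
  have h0 : ∀ z, edist (u z) (u (Function.surjInv hv (v z))) = 0 := fun z => by
    obtain ⟨a, ha⟩ := hne z
    refine le_antisymm ?_ bot_le
    simpa using huv z _ a ha a (by rwa [Function.surjInv_eq hv])
  calc edist (u z) (u w)
      ≤ edist (u z) (u (Function.surjInv hv (v z))) +
          edist (u (Function.surjInv hv (v z))) (u (Function.surjInv hv (v w))) +
          edist (u (Function.surjInv hv (v w))) (u w) := edist_triangle4 _ _ _ _
    _ = edist (u (Function.surjInv hv (v z))) (u (Function.surjInv hv (v w))) := by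
        rw [h0, edist_comm _ (u w), h0, zero_add, add_zero]
    _ ≤ C * edist (v z) (v w) :=
        le_mul_edist_block
          (e := fun L L' => edist (u (Function.surjInv hv L)) (u (Function.surjInv hv L')))
          (fun _ => edist_self _) (fun _ _ _ => edist_triangle _ _ _) hC
          (fun L L' a ha b hb => huv _ _ a (by rwa [Function.surjInv_eq hv]) b
            (by rwa [Function.surjInv_eq hv])) _ _

theorem edist_block_le {L L' : Block m 𝓑} {a b : X} (ha : a ∈ L.carrier) (hb : b ∈ L'.carrier) :
    edist L L' ≤ m.edist a b := by
  change chainDist L L' ≤ _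
  refine iInf_le_of_le 1 (iInf_le_of_le (fun i => if i = 0 then L else L')
    (iInf_le_of_le ⟨by simp, by simp⟩ ?_))
  simpa [setDist] using iInf₂_le_of_le a ha (iInf₂_le b hb)

end Blocks

/-- Two pseudometric spaces that carry surjections from the same set, inducing equivalent
pseudodistances on it, have homeomorphic metric quotients. -/
theorem nonempty_separationQuotient_homeomorph {F X Y : Type*} [PseudoEMetricSpace X]
    [PseudoEMetricSpace Y] {u : F → X} {v : F → Y} (hu : Function.Surjective u)
    (hv : Function.Surjective v) {C D : ℝ≥0} (huv : ∀ z w, edist (u z) (u w) ≤ C * edist (v z) (v w))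
    (hvu : ∀ z w, edist (v z) (v w) ≤ D * edist (u z) (u w)) :
    Nonempty (SeparationQuotient X ≃ₜ SeparationQuotient Y) := by
  -- a Lipschitz map `α` with `α (u z)` at distance zero from `v z`, and likewise `β`
  set α : X → Y := fun x => v (Function.surjInv hu x)
  set β : Y → X := fun y => u (Function.surjInv hv y)
  have hα : LipschitzWith D α := fun x x' => by
    simpa [Function.surjInv_eq hu] using hvu (Function.surjInv hu x) (Function.surjInv hu x')
  have hβ : LipschitzWith C β := fun y y' => by
    simpa [Function.surjInv_eq hv] using huv (Function.surjInv hv y) (Function.surjInv hv y')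
  have hβα : ∀ x, Inseparable (β (α x)) x := fun x => by
    refine EMetric.inseparable_iff.2 (le_antisymm ?_ bot_le)
    simpa [α, β, Function.surjInv_eq] using
      huv (Function.surjInv hv (α x)) (Function.surjInv hu x)
  have hαβ : ∀ y, Inseparable (α (β y)) y := fun y => by
    refine EMetric.inseparable_iff.2 (le_antisymm ?_ bot_le)
    simpa [α, β, Function.surjInv_eq] using
      hvu (Function.surjInv hu (β y)) (Function.surjInv hv y)
  exact ⟨{
    toFun := SeparationQuotient.lift (SeparationQuotient.mk ∘ α) fun x x' hx =>
      SeparationQuotient.mk_eq_mk.2 (hx.map hα.continuous)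
    invFun := SeparationQuotient.lift (SeparationQuotient.mk ∘ β) fun y y' hy =>
      SeparationQuotient.mk_eq_mk.2 (hy.map hβ.continuous)
    left_inv := SeparationQuotient.surjective_mk.forall.2 fun x => by
      simpa using hβα x
    right_inv := SeparationQuotient.surjective_mk.forall.2 fun y => by
      simpa using hαβ y
    continuous_toFun := SeparationQuotient.continuous_lift
      (SeparationQuotient.continuous_mk.comp hα.continuous)
    continuous_invFun := SeparationQuotient.continuous_lift
      (SeparationQuotient.continuous_mk.comp hβ.continuous) }⟩

/-! ### Smoothness of the quotient map -/

section Pushforward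

variable {E : Type*} [NormedAddCommGroup E] [NormedSpace ℝ E]
  {H : Type*} [TopologicalSpace H] {I : ModelWithCorners ℝ E H}
  {M : Type*} [TopologicalSpace M] [ChartedSpace H M] [IsManifold I ∞ M]
  {N : Type*} [TopologicalSpace N]

/-- Near each point `y` of the base, `f` has a local section that is smooth at `y`, and `f` is smooth
at the value of that section. -/
theorem exists_contMDiffAt_localInverse {f : M → N} (hf : IsLocalHomeomorph f)
    (hs : Function.Surjective f)
    (hG : ∀ a b, f a = f b → ∃ γ : M ≃ₘ⟮I, I⟯ M, γ a = b ∧ ∀ x, f (γ x) = f x) (y : N) :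
    letI : ChartedSpace H N := hf.chartedSpace hs
    ∃ l : OpenPartialHomeomorph N M, y ∈ l.source ∧ ⇑l.symm = f ∧ ContMDiffAt I I ∞ l y ∧
      ContMDiffAt I I ∞ f (l y) := by
  let : ChartedSpace H N := hf.chartedSpace hs
  have : IsManifold I ∞ N := isManifold_of_isLocalHomeomorph hf hs hG
  set b := hs.hasRightInverse.choose y
  have hb : f b = y := hs.hasRightInverse.choose_spec y
  set l := hf.localInverseAt b
  have hyl : y ∈ l.source := hb ▸ hf.apply_self_mem_localInverseAt_source
  have hly : l y = b := by rw [← hb]; exact hf.localInverseAt_apply_self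
  have hlsymm : ∀ y, l.symm y = f y := fun y => congrFun (hf.localInverseAt_symm _) y
  have hchart : chartAt H y = l.trans (chartAt H b) := rfl
  refine ⟨l, hyl, hf.localInverseAt_symm _, ?_, ?_⟩
  · have h1 : ContMDiffAt I I ∞ ((chartAt H b).symm ∘ chartAt H y) y := by
      refine ContMDiffAt.comp y ?_
        (contMDiffAt_of_mem_maximalAtlas (IsManifold.chart_mem_maximalAtlas y) (mem_chart_source H y))
      refine contMDiffAt_symm_of_mem_maximalAtlas (IsManifold.chart_mem_maximalAtlas _) ?_
      simp [hchart, hly]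
    refine h1.congr_of_eventuallyEq ?_
    filter_upwards [(chartAt H y).open_source.mem_nhds (mem_chart_source H y)] with w hw
    rw [hchart] at hw ⊢
    simp only [mfld_simps] at hw ⊢
    exact ((chartAt H b).left_inv hw.2).symm
  · rw [hly]
    have h1 : ContMDiffAt I I ∞ ((chartAt H y).symm ∘ chartAt H b) b := by
      refine ContMDiffAt.comp b ?_
        (contMDiffAt_of_mem_maximalAtlas (IsManifold.chart_mem_maximalAtlas b) (mem_chart_source H b))
      refine contMDiffAt_symm_of_mem_maximalAtlas (IsManifold.chart_mem_maximalAtlas _) ?_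
      have := (chartAt H y).map_source (mem_chart_source H y)
      rwa [show chartAt H y y = chartAt H b b by simp [hchart, hly]] at this
    refine h1.congr_of_eventuallyEq ?_
    filter_upwards [(chartAt H b).open_source.mem_nhds (mem_chart_source H b)] with w hw
    rw [hchart]
    simp [hw, hlsymm]

theorem contMDiff_of_isLocalHomeomorph {f : M → N} (hf : IsLocalHomeomorph f)
    (hs : Function.Surjective f)
    (hG : ∀ a b, f a = f b → ∃ γ : M ≃ₘ⟮I, I⟯ M, γ a = b ∧ ∀ x, f (γ x) = f x) :
    letI : ChartedSpace H N := hf.chartedSpace hs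
    ContMDiff I I ∞ f := by
  let : ChartedSpace H N := hf.chartedSpace hs
  intro a
  obtain ⟨l, hal, hl, -, hfl⟩ := exists_contMDiffAt_localInverse hf hs hG (f a)
  obtain ⟨γ, hγa, hγ⟩ := hG a (l (f a)) (by
    have := l.left_inv hal
    rw [hl] at this
    exact this.symm)
  rw [← hγa] at hfl
  have := hfl.comp a γ.contMDiff.contMDiffAt
  rwa [show f ∘ γ = f from funext hγ] at this

end Pushforward
/-! ### The suspension and its fibre -/

section SuspensionFibre

variable {n q : ℕ}
  {B : Type*} [TopologicalSpace B] [ChartedSpace (EuclideanSpace ℝ (Fin n)) B]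
  {B' : Type*} [TopologicalSpace B'] [ChartedSpace (EuclideanSpace ℝ (Fin n)) B']
  {F : Type*} [TopologicalSpace F] [ChartedSpace (EuclideanSpace ℝ (Fin q)) F]
  (p : UniversalCovering n B' B) (h : p.deck →* (F ≃ₘ⟮𝓡 q, 𝓡 q⟯ F))

/-- Covering transformations that agree at one point agree. -/
theorem UniversalCovering.deck_ext {γ δ : p.deck} {x : B'} (hx : γ.1 x = δ.1 x) : γ = δ := by
  have := p.simplyConnected
  have : (γ.1 : B' → B') = δ.1 :=
    p.isCoveringMap.eq_of_comp_eq γ.1.continuous δ.1.continuous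
      (funext fun x => (γ.2 x).trans (δ.2 x).symm) x hx
  exact Subtype.ext (Diffeomorph.ext fun x => congrFun this x)

/-- If the suspension is compact, so is its fibre: `F` embeds in the suspension as a fibre of the
bundle projection to the Hausdorff space `B`, which is closed. -/
theorem compactSpace_fibre [T2Space B] [CompactSpace (Suspension p h)] : CompactSpace F := by
  have := p.simplyConnected
  obtain ⟨x₀⟩ : Nonempty B' := inferInstance
  refine isCompact_univ_iff.1 ((isCompact_iff_ultrafilter_le_nhds).2 fun 𝒰 _ => ?_)
  set f : F → Suspension p h := fun z => Suspension.proj p h (x₀, z)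
  obtain ⟨m, -, hm⟩ := (isCompact_iff_ultrafilter_le_nhds).1
    (isCompact_univ (X := Suspension p h)) (𝒰.map f) (by simp)
  have hf : Filter.Tendsto f 𝒰 (𝓝 m) := hm
  -- lift the convergence to `B' × F` by a local section `l`
  obtain ⟨a, rfl⟩ := Suspension.proj_surjective p h m
  set l := (Suspension.isLocalHomeomorph_proj p h).localInverseAt a
  have hls : Suspension.proj p h a ∈ l.source :=
    (Suspension.isLocalHomeomorph_proj p h).apply_self_mem_localInverseAt_source
  have hla : l (Suspension.proj p h a) = a :=
    (Suspension.isLocalHomeomorph_proj p h).localInverseAt_apply_self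
  have hlf : Filter.Tendsto (fun z => l (f z)) 𝒰 (𝓝 a) := by
    simpa only [hla, Function.comp_def] using (l.continuousAt hls).tendsto.comp hf
  have hl : ∀ᶠ z in (𝒰 : Filter F), ∃ γ : p.deck, (γ.1 x₀, h γ z) = l (f z) := by
    filter_upwards [hf.eventually (l.open_source.mem_nhds hls)] with z hz
    exact (Suspension.proj_eq_iff p h).1
      ((Suspension.isLocalHomeomorph_proj p h).apply_localInverseAt_of_mem hz)
  have hfst : Filter.Tendsto (fun z => (l (f z)).1) 𝒰 (𝓝 a.1) := (continuous_fst.tendsto a).comp hlf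
  have hsnd : Filter.Tendsto (fun z => (l (f z)).2) 𝒰 (𝓝 a.2) := (continuous_snd.tendsto a).comp hlf
  -- the limit point lies over the same point of `B` as `x₀`, because `B` is Hausdorff
  have hpa : p.toFun a.1 = p.toFun x₀ := by
    refine tendsto_nhds_unique ((p.isCoveringMap.continuous.tendsto a.1).comp hfst) ?_
    refine tendsto_const_nhds.congr' ?_
    filter_upwards [hl] with z ⟨γ, hγ⟩
    simpa [← hγ] using (γ.2 x₀).symm
  -- as fibres of the covering are discrete, the first coordinate is eventually constant
  obtain ⟨U, hU, hinj⟩ := isLocallyInjective_iff_nhds.1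
    p.isCoveringMap.isLocalHomeomorph.isLocallyInjective a.1
  have hev : ∀ᶠ z in (𝒰 : Filter F), ∃ γ : p.deck, γ.1 x₀ = a.1 ∧ h γ z = (l (f z)).2 := by
    filter_upwards [hl, hfst.eventually hU] with z ⟨γ, hγ⟩ hz
    rw [← hγ] at hz
    exact ⟨γ, hinj hz (mem_of_mem_nhds hU) ((γ.2 x₀).trans hpa.symm), by rw [← hγ]⟩
  obtain ⟨-, γ, hγ, -⟩ := hev.exists
  have hγz : Filter.Tendsto (h γ) 𝒰 (𝓝 a.2) := by
    refine hsnd.congr' ?_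
    filter_upwards [hev] with z ⟨δ, hδ, hδz⟩
    rw [← hδz, p.deck_ext (hδ.trans hγ.symm)]
  refine ⟨(h γ).symm a.2, mem_univ _, ?_⟩
  have := ((h γ).symm.continuous.tendsto a.2).comp hγz
  simpa [Function.comp_def, Filter.Tendsto] using this

theorem Suspension.exists_diffeomorph_of_proj_eq (a b : B' × F)
    (hab : Suspension.proj p h a = Suspension.proj p h b) :
    ∃ γ : (B' × F) ≃ₘ⟮(𝓡 n).prod (𝓡 q), (𝓡 n).prod (𝓡 q)⟯ (B' × F),
      γ a = b ∧ ∀ x, Suspension.proj p h (γ x) = Suspension.proj p h x := by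
  obtain ⟨γ, hγ⟩ := (Suspension.proj_eq_iff p h).1 hab.symm
  exact ⟨γ.1.prodCongr (h γ), hγ, fun x => (Suspension.proj_eq_iff p h).2 ⟨γ, rfl⟩⟩

variable [IsManifold (𝓡 q) ∞ F]

/-- The orbit of `z` under the group `h(Γ)`. -/
def orbitBlock (gF : Metric (𝓡 q) F) (z : F) :
    Block gF.dist (range fun z : F => MulAction.orbit h.range z) :=
  ⟨MulAction.orbit h.range z, z, rfl⟩

theorem orbitBlock_map (gF : Metric (𝓡 q) F) (γ : p.deck) (z : F) :
    orbitBlock p h gF (h γ z) = orbitBlock p h gF z := by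
  have : MulAction.orbit h.range (h γ z) = MulAction.orbit h.range z :=
    MulAction.orbit_eq_iff.2 ⟨⟨h γ, γ, rfl⟩, rfl⟩
  simp only [orbitBlock, this]

variable [IsManifold (𝓡 n) ∞ B']

theorem Suspension.contMDiff_proj :
    ContMDiff ((𝓡 n).prod (𝓡 q)) ((𝓡 n).prod (𝓡 q)) ∞ (Suspension.proj p h) :=
  contMDiff_of_isLocalHomeomorph (Suspension.isLocalHomeomorph_proj p h)
    (Suspension.proj_surjective p h) (Suspension.exists_diffeomorph_of_proj_eq p h)

/-- The leaf through the points of `B' × {z}`. -/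
def leafBlock (g : Metric ((𝓡 n).prod (𝓡 q)) (Suspension p h)) (z : F) :
    Block g.dist (Suspension.leaves p h) :=
  ⟨Suspension.proj p h '' (univ ×ˢ {z}), z, rfl⟩

/-- The distance of leaves is bounded by a multiple of the distance of orbits, because a fibre of
the suspension is the image of a smooth map on the compact manifold `F`. -/
theorem exists_edist_leafBlock_le [CompactSpace F]
    (g : Metric ((𝓡 n).prod (𝓡 q)) (Suspension p h)) (gF : Metric (𝓡 q) F) :
    ∃ C : ℝ≥0, ∀ z w, edist (leafBlock p h g z) (leafBlock p h g w) ≤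
      C * edist (orbitBlock p h gF z) (orbitBlock p h gF w) := by
  have := p.simplyConnected
  obtain ⟨x₀⟩ : Nonempty B' := inferInstance
  have hmem : ∀ x z, Suspension.proj p h (x, z) ∈ (leafBlock p h g z).carrier :=
    fun x z => ⟨(x, z), by simp, rfl⟩
  obtain ⟨C, hC, hCe⟩ := exists_le_mul_dist gF g
    (e := fun z w => edist (leafBlock p h g z) (leafBlock p h g w))
    (fun _ => edist_self _) (fun _ _ _ => edist_triangle _ _ _) fun z =>
      ⟨fun w => Suspension.proj p h (x₀, w),
        ((Suspension.contMDiff_proj p h).comp (contMDiff_const.prodMk contMDiff_id)).of_le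
          (by simp) |>.contMDiffAt, univ, Filter.univ_mem,
        fun w _ w' _ => edist_block_le (hmem x₀ w) (hmem x₀ w')⟩
  refine ⟨C, edist_le_mul_edist_block (v := orbitBlock p h gF) ?_ (fun z => ?_) hC ?_⟩
  · rintro ⟨_, z, rfl⟩
    exact ⟨z, rfl⟩
  · exact MulAction.nonempty_orbit z
  · -- leaves through points of the same orbit are at distance zero, as they meet
    have h0 : ∀ (γ : p.deck) z, edist (leafBlock p h g z) (leafBlock p h g (h γ z)) = 0 :=
      fun γ z => by
        refine le_antisymm ((edist_block_le (hmem x₀ z) (hmem (γ.1 x₀) (h γ z))).trans_eq ?_) bot_le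
        rw [(Suspension.proj_eq_iff p h (b := (x₀, z))).2 ⟨γ, rfl⟩]
        exact g.dist.edist_self _
    rintro z w _ ⟨⟨_, γ, rfl⟩, rfl⟩ _ ⟨⟨_, δ, rfl⟩, rfl⟩
    calc edist (leafBlock p h g z) (leafBlock p h g w)
        ≤ edist (leafBlock p h g z) (leafBlock p h g (h γ z)) +
            edist (leafBlock p h g (h γ z)) (leafBlock p h g (h δ w)) +
            edist (leafBlock p h g (h δ w)) (leafBlock p h g w) := edist_triangle4 _ _ _ _
      _ = edist (leafBlock p h g (h γ z)) (leafBlock p h g (h δ w)) := by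
          rw [h0, edist_comm _ (leafBlock p h g w), h0, zero_add, add_zero]
      _ ≤ _ := hCe _ _

/-- The distance of orbits is bounded by a multiple of the distance of leaves: the second coordinate
of a local section of the canonical projection is smooth, and it sends the points of a leaf to
points of the corresponding orbit. -/
theorem exists_edist_orbitBlock_le [CompactSpace (Suspension p h)]
    (g : Metric ((𝓡 n).prod (𝓡 q)) (Suspension p h)) (gF : Metric (𝓡 q) F) :
    ∃ C : ℝ≥0, ∀ z w, edist (orbitBlock p h gF z) (orbitBlock p h gF w) ≤
      C * edist (leafBlock p h g z) (leafBlock p h g w) := by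
  have := p.simplyConnected
  obtain ⟨x₀⟩ : Nonempty B' := inferInstance
  -- the orbit that corresponds to the leaf of a point of the suspension
  set o : Suspension p h → Block gF.dist (range fun z : F => MulAction.orbit h.range z) :=
    fun y => orbitBlock p h gF (Function.surjInv (Suspension.proj_surjective p h) y).2
  have ho : ∀ a, o (Suspension.proj p h a) = orbitBlock p h gF a.2 := fun a => by
    obtain ⟨γ, hγ⟩ := (Suspension.proj_eq_iff p h).1
      (Function.surjInv_eq (Suspension.proj_surjective p h) (Suspension.proj p h a))
    simp only [o, ← hγ, orbitBlock_map]
  obtain ⟨C, hC, hCe⟩ := exists_le_mul_dist g gF (e := fun y y' => edist (o y) (o y'))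
    (fun _ => edist_self _) (fun _ _ _ => edist_triangle _ _ _) fun y => by
      obtain ⟨l, hyl, hl, hsmooth, -⟩ := exists_contMDiffAt_localInverse
        (Suspension.isLocalHomeomorph_proj p h) (Suspension.proj_surjective p h)
        (Suspension.exists_diffeomorph_of_proj_eq p h) y
      refine ⟨fun y => (l y).2, (contMDiffAt_snd.comp y hsmooth).of_le (by simp),
        l.source, l.open_source.mem_nhds hyl, fun w hw w' hw' => ?_⟩
      rw [← l.left_inv hw, ← l.left_inv hw', hl, ho, ho, ← hl, l.left_inv hw, l.left_inv hw']
      exact edist_block_le (MulAction.mem_orbit_self _) (MulAction.mem_orbit_self _)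
  refine ⟨C, edist_le_mul_edist_block (v := leafBlock p h g) ?_ (fun z => ?_) hC ?_⟩
  · rintro ⟨_, z, rfl⟩
    exact ⟨z, rfl⟩
  · exact ⟨_, (x₀, z), by simp, rfl⟩
  · rintro z w _ ⟨⟨x, _⟩, ⟨-, rfl⟩, rfl⟩ _ ⟨⟨y, _⟩, ⟨-, rfl⟩, rfl⟩
    simpa only [ho] using hCe (Suspension.proj p h (x, _)) (Suspension.proj p h (y, _))

end SuspensionFibre
end SuspensionHLS

theorem mainTheorem10 {n q : ℕ}
    {B : Type*} [TopologicalSpace B] [T2Space B] [SecondCountableTopology B] [ConnectedSpace B]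
    [ChartedSpace (EuclideanSpace ℝ (Fin n)) B] [IsManifold (𝓡 n) ∞ B]
    {B' : Type*} [TopologicalSpace B'] [T2Space B'] [SecondCountableTopology B']
    [ChartedSpace (EuclideanSpace ℝ (Fin n)) B'] [IsManifold (𝓡 n) ∞ B']
    {F : Type*} [TopologicalSpace F] [T2Space F] [SecondCountableTopology F]
    [ChartedSpace (EuclideanSpace ℝ (Fin q)) F] [IsManifold (𝓡 q) ∞ F]
    (p : SuspensionHLS.UniversalCovering n B' B)
    (h : p.deck →* (F ≃ₘ⟮𝓡 q, 𝓡 q⟯ F))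
    [CompactSpace (SuspensionHLS.Suspension p h)]
    (g : SuspensionHLS.Metric ((𝓡 n).prod (𝓡 q)) (SuspensionHLS.Suspension p h))
    (gF : SuspensionHLS.Metric (𝓡 q) F) :
    Nonempty (SuspensionHLS.HLS (SuspensionHLS.Suspension.leaves p h) g ≃ₜ
      SuspensionHLS.HOS h.range gF.dist) := by
  have := SuspensionHLS.compactSpace_fibre p h
  obtain ⟨C, hC⟩ := SuspensionHLS.exists_edist_leafBlock_le p h g gF
  obtain ⟨D, hD⟩ := SuspensionHLS.exists_edist_orbitBlock_le p h g gF
  refine SuspensionHLS.nonempty_separationQuotient_homeomorph ?_ ?_ hC hD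
  · rintro ⟨_, z, rfl⟩
    exact ⟨z, rfl⟩
  · rintro ⟨_, z, rfl⟩
    exact ⟨z, rfl⟩
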